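/- Let $\mathcal H$ be a finite-dimensional complex Hilbert space. For $\alpha\in(1,\infty)$ and positive semidefinite operators $A,B$ on $\mathcal H$, let \[ \widetilde Q_\alpha(A\|B)=\begin{cases}\operatorname{Tr}\Big\{\big(B^{\frac{1-\alpha}{2\alpha}}\,A\,B^{\frac{1-\alpha}{2\alpha}}\big)^{\alpha}\Big\} & \text{if } \operatorname{supp}(A)\subseteq\operatorname{supp}(B),\\ \infty & \text{otherwise,}\end{cases} \] where $\operatorname{supp}(X)=(\ker X)^{\perp}$ and negative powers of $B$ are taken on $\operatorname{supp}(B)$ (and vanish on $\ker B$). The sandwiched Rényi relative entropy is \[ \widetilde D_\alpha(A\|B)=\frac{1}{\alpha-1}\log_2\widetilde Q_\alpha(A\|B)\in[-\infty,\infty], \] with the conventions $\log_2 0=-\infty$ and $\log_2\infty=\infty$. **Corollary (Positivity and equality conditions).** Let $\rho,\sigma$ be density operators on $\mathcal H$ (positive semidefinite operators of trace one) and let $\alpha\in(1,2]$. Then $\widetilde D_\alpha(\rho\|\sigma)\ge 0$, and $\widetilde D_\alpha(\rho\|\sigma)=0$ if and only if $\rho=\sigma$. -/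

import Mathlib

noncomputable section

/-- The support of an operator: the orthogonal complement of its kernel. -/
def opSupport {H : Type*} [NormedAddCommGroup H] [InnerProductSpace ℂ H]
    (A : H →L[ℂ] H) : Submodule ℂ H :=
  (LinearMap.ker (A : H →ₗ[ℂ] H))ᗮ

/-- A density operator: a positive semidefinite operator of unit trace. -/
structure IsDensityOperator {H : Type*} [NormedAddCommGroup H] [InnerProductSpace ℂ H]
    (ρ : H →L[ℂ] H) : Prop where
  isPositive : ρ.IsPositive
  trace_eq_one : LinearMap.trace ℂ H (ρ : H →ₗ[ℂ] H) = 1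

open Classical in
/-- The sandwiched quasi-relative entropy `Q̃_α(A‖B)` of positive semidefinite operators, for
`α > 1`. Real powers are taken in the functional calculus, where `0 ^ p = 0` for every `p ≠ 0`,
so that the negative power of `B` is the power of its inverse on the support of `B`. The trace is
a nonnegative real number, being that of a positive semidefinite operator. -/
def sandwichedQuasiEntropy {H : Type*} [NormedAddCommGroup H] [InnerProductSpace ℂ H]
    [CompleteSpace H] (α : ℝ) (A B : H →L[ℂ] H) : ENNReal :=
  if opSupport A ≤ opSupport B then
    ENNReal.ofReal (LinearMap.trace ℂ H
      (((B ^ ((1 - α) / (2 * α)) * A * B ^ ((1 - α) / (2 * α))) ^ α : H →L[ℂ] H) :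
        H →ₗ[ℂ] H)).re
  else ⊤

/-- The sandwiched Rényi relative entropy `D̃_α(A‖B) = (α - 1)⁻¹ log₂ Q̃_α(A‖B)`, an extended real
number, with the logarithm taken to base two and `log 0 = -∞`, `log ∞ = ∞`. -/
def sandwichedRenyiEntropy {H : Type*} [NormedAddCommGroup H] [InnerProductSpace ℂ H]
    [CompleteSpace H] (α : ℝ) (A B : H →L[ℂ] H) : EReal :=
  ((1 / (α - 1) : ℝ) : EReal) *
    (((1 / Real.log 2 : ℝ) : EReal) * ENNReal.log (sandwichedQuasiEntropy α A B))

end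

open Module ContinuousLinearMap
open scoped InnerProductSpace

section RealInequalities

/-! Put `s = (1 - α) / (2α)` and `X = σ ^ s * ρ * σ ^ s`. Support inclusion gives `Tr (σ ^ ((α - 1)
/ α) X) = Tr ρ = 1`. Young's inequality under the trace bounds this by `(1 / α) Tr X ^ α + (α - 1) /
α`, so `Tr X ^ α ≥ 1`; equality forces `X = σ ^ (1 / α)`, hence `ρ = σ`. The trace inequality
(`sum_mul_re_inner_le`) is scalar Young for pairs of eigenvalues of `X` and `σ`, averaged with the
squared overlaps of the two eigenbases. -/

lemma mul_rpow_le_weighted_add {α x y : ℝ} (hα : 1 < α) (hx : 0 ≤ x) (hy : 0 ≤ y) :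
    x * y ^ ((α - 1) / α) ≤ 1 / α * x ^ α + (α - 1) / α * y := by
  have h0 : 0 < α := by linarith
  have h := Real.geom_mean_le_arith_mean2_weighted (w₁ := 1 / α) (w₂ := (α - 1) / α)
    (p₁ := x ^ α) (p₂ := y) (by positivity) (div_nonneg (by linarith) h0.le)
    (by positivity) hy (by field_simp; ring)
  rwa [← Real.rpow_mul hx, mul_one_div_cancel h0.ne', Real.rpow_one] at h

lemma mul_rpow_eq_weighted_add_iff {α x y : ℝ} (hα : 1 < α) (hx : 0 ≤ x) (hy : 0 ≤ y) :
    x * y ^ ((α - 1) / α) = 1 / α * x ^ α + (α - 1) / α * y ↔ x ^ α = y := by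
  have h0 : 0 < α := by linarith
  have h := Real.geom_mean_eq_arith_mean2_weighted_iff_of_pos (w₁ := 1 / α) (w₂ := (α - 1) / α)
    (p₁ := x ^ α) (p₂ := y) (by positivity) (div_pos (by linarith) h0)
    (by positivity) hy (by field_simp; ring)
  rwa [← Real.rpow_mul hx, mul_one_div_cancel h0.ne', Real.rpow_one] at h

end RealInequalities

section Operators

variable {H : Type*} [NormedAddCommGroup H] [InnerProductSpace ℂ H]

lemma ContinuousLinearMap.finite_real_spectrum [FiniteDimensional ℂ H] (A : H →L[ℂ] H) :
    (spectrum ℝ A).Finite := by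
  have h : (spectrum ℂ A).Finite := by
    have := Module.End.finite_spectrum (A : H →ₗ[ℂ] H)
    refine this.subset fun z hz => ?_
    rw [spectrum.mem_iff] at hz ⊢
    contrapose! hz
    have : IsUnit ((LinearMap.toContinuousLinearMap (E := H) (F' := H) (𝕜 := ℂ))
      (algebraMap ℂ (Module.End ℂ H) z - (A : H →ₗ[ℂ] H))) := by
      exact hz.map (Module.End.toContinuousLinearMap H)
    exact this
  exact h.preimage (f := (algebraMap ℝ ℂ)) (algebraMap ℝ ℂ).injective.injOn

/-- An eigenvector of a nonnegative operator is an eigenvector of its real powers. -/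
lemma rpow_apply_of_apply_eq_smul [FiniteDimensional ℂ H] [CompleteSpace H] {A : H →L[ℂ] H}
    (hA : 0 ≤ A) {v : H} {y : ℝ} (hv : A v = (y : ℂ) • v) (p : ℝ) :
    (A ^ p) v = ((y ^ p : ℝ) : ℂ) • v := by
  classical
  have hfin := A.finite_real_spectrum
  -- The spectrum is finite, so `A ^ p` is a polynomial in `A`. Adding `y` as a node avoids showing
  -- that it lies in the spectrum, which may fail for `v = 0`.
  set q : Polynomial ℝ := Lagrange.interpolate (insert y hfin.toFinset) id (fun x => x ^ p)
  have hq : ∀ x ∈ insert y hfin.toFinset, q.eval x = x ^ p := fun x hx =>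
    Lagrange.eval_interpolate_at_node (v := id) (fun x : ℝ => x ^ p) (Function.injective_id.injOn) hx
  have h : A ^ p = Polynomial.aeval A q := by
    rw [CFC.rpow_eq_cfc_real hA, ← cfc_polynomial q A (IsSelfAdjoint.of_nonneg hA)]
    exact cfc_congr fun x hx => (hq x (by simp [hx])).symm
  have hpoly : ∀ q : Polynomial ℝ, Polynomial.aeval A q v = ((q.eval y : ℝ) : ℂ) • v := by
    intro q
    induction q using Polynomial.induction_on' with
    | add a b ha hb => simp [ha, hb, add_smul]
    | monomial n a =>
      have hpow : ∀ n : ℕ, (A ^ n) v = ((y : ℂ) ^ n) • v := by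
        intro n
        induction n with
        | zero => simp
        | succ n ih => rw [pow_succ', mul_apply_eq_comp, ih, map_smul, hv, smul_smul, pow_succ]
      simp [Polynomial.aeval_monomial, Polynomial.eval_monomial, hpow,
        Algebra.algebraMap_eq_smul_one, mul_smul]
  rw [h, hpoly, hq y (by simp)]

lemma exists_eigenbasis_of_nonneg [FiniteDimensional ℂ H] [CompleteSpace H] {A : H →L[ℂ] H}
    (hA : 0 ≤ A) :
    ∃ (b : OrthonormalBasis (Fin (finrank ℂ H)) ℂ H) (y : Fin (finrank ℂ H) → ℝ),
      (∀ i, 0 ≤ y i) ∧ ∀ i, A (b i) = (y i : ℂ) • b i := by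
  have hp := (nonneg_iff_isPositive A).1 hA
  have hs : (A : H →ₗ[ℂ] H).IsSymmetric := hp.isSymmetric
  refine ⟨hs.eigenvectorBasis rfl, hs.eigenvalues rfl, fun i => ?_, fun i => ?_⟩
  · exact (LinearMap.IsPositive.nonneg_eigenvalues (hp.toLinearMap) rfl i)
  · exact hs.apply_eigenvectorBasis rfl i

lemma OrthonormalBasis.re_inner_apply_self {ι : Type*} [Fintype ι] (e : OrthonormalBasis ι ℂ H)
    {X : H →L[ℂ] H} {x : ι → ℝ} (hX : ∀ i, X (e i) = (x i : ℂ) • e i) (v : H) :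
    (⟪v, X v⟫_ℂ).re = ∑ i, x i * ‖⟪e i, v⟫_ℂ‖ ^ 2 := by
  conv_lhs => rw [← e.sum_repr' v]
  rw [map_sum, e.sum_repr' v, inner_sum, Complex.re_sum]
  refine Finset.sum_congr rfl fun i _ => ?_
  rw [map_smul, hX, inner_smul_right, inner_smul_right, ← inner_conj_symm v (e i),
    mul_left_comm, Complex.mul_conj, Complex.normSq_eq_norm_sq, ← Complex.ofReal_mul,
    Complex.ofReal_re]

/-- For an orthonormal basis `f`, weights `c j = y j ^ ((α - 1) / α)` and a nonnegative operator
`X`, this is Hölder's inequality in the form of Young. -/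
lemma sum_mul_re_inner_le [FiniteDimensional ℂ H] [CompleteSpace H] {ι : Type*} [Fintype ι]
    {X : H →L[ℂ] H} (hX : 0 ≤ X) (f : OrthonormalBasis ι ℂ H) {y : ι → ℝ} (hy : ∀ j, 0 ≤ y j)
    {α : ℝ} (hα : 1 < α) :
    ∑ j, y j ^ ((α - 1) / α) * (⟪f j, X (f j)⟫_ℂ).re ≤
      1 / α * ∑ j, (⟪f j, (X ^ α) (f j)⟫_ℂ).re + (α - 1) / α * ∑ j, y j ∧
    (∑ j, y j ^ ((α - 1) / α) * (⟪f j, X (f j)⟫_ℂ).re =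
      1 / α * ∑ j, (⟪f j, (X ^ α) (f j)⟫_ℂ).re + (α - 1) / α * ∑ j, y j →
      ∀ j, X (f j) = ((y j ^ (1 / α) : ℝ) : ℂ) • f j) := by
  obtain ⟨e, x, hx, he⟩ := exists_eigenbasis_of_nonneg hX
  have h0 : 0 < α := by linarith
  have hl : ∑ j, y j ^ ((α - 1) / α) * (⟪f j, X (f j)⟫_ℂ).re =
      ∑ j, ∑ i, (x i * y j ^ ((α - 1) / α)) * ‖⟪e i, f j⟫_ℂ‖ ^ 2 := by
    refine Finset.sum_congr rfl fun j _ => ?_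
    rw [e.re_inner_apply_self he, Finset.mul_sum]
    exact Finset.sum_congr rfl fun i _ => by ring
  have hr : 1 / α * ∑ j, (⟪f j, (X ^ α) (f j)⟫_ℂ).re + (α - 1) / α * ∑ j, y j =
      ∑ j, ∑ i, (1 / α * x i ^ α + (α - 1) / α * y j) * ‖⟪e i, f j⟫_ℂ‖ ^ 2 := by
    rw [Finset.mul_sum, Finset.mul_sum, ← Finset.sum_add_distrib]
    refine Finset.sum_congr rfl fun j _ => ?_
    have h1 : ∑ i, ‖⟪e i, f j⟫_ℂ‖ ^ 2 = 1 := by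
      rw [e.sum_sq_norm_inner_right]; simp
    rw [e.re_inner_apply_self fun i => rpow_apply_of_apply_eq_smul hX (he i) α]
    simp_rw [add_mul, Finset.sum_add_distrib, ← Finset.mul_sum, h1, mul_one, mul_assoc,
      ← Finset.mul_sum]
  have hle : ∀ j i, (x i * y j ^ ((α - 1) / α)) * ‖⟪e i, f j⟫_ℂ‖ ^ 2 ≤
      (1 / α * x i ^ α + (α - 1) / α * y j) * ‖⟪e i, f j⟫_ℂ‖ ^ 2 := fun j i =>
    mul_le_mul_of_nonneg_right (mul_rpow_le_weighted_add hα (hx i) (hy j)) (sq_nonneg _)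
  rw [hl, hr]
  refine ⟨Finset.sum_le_sum fun j _ => Finset.sum_le_sum fun i _ => hle j i, fun heq j => ?_⟩
  rw [Finset.sum_eq_sum_iff_of_le fun j _ => Finset.sum_le_sum fun i _ => hle j i] at heq
  have hj := heq j (Finset.mem_univ j)
  rw [Finset.sum_eq_sum_iff_of_le fun i _ => hle j i] at hj
  conv_lhs => rw [← e.sum_repr' (f j)]
  conv_rhs => rw [← e.sum_repr' (f j)]
  rw [map_sum, Finset.smul_sum]
  refine Finset.sum_congr rfl fun i _ => ?_
  rw [map_smul, he, smul_comm]
  -- Equality holds term by term: wherever the overlap is nonzero, `x i ^ α = y j`, so `X` acts on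
  -- that component of `f j` as `y j ^ (1 / α)`.
  by_cases hz : ⟪e i, f j⟫_ℂ = 0
  · simp [hz]
  · have hxy := (mul_rpow_eq_weighted_add_iff hα (hx i) (hy j)).1
      (mul_right_cancel₀ (pow_ne_zero 2 (norm_ne_zero_iff.2 hz)) (hj i (Finset.mem_univ i)))
    rw [← hxy, ← Real.rpow_mul (hx i), mul_one_div_cancel h0.ne', Real.rpow_one]

lemma ker_le_ker_of_opSupport_le [FiniteDimensional ℂ H] {A B : H →L[ℂ] H}
    (h : opSupport A ≤ opSupport B) {v : H} (hv : B v = 0) : A v = 0 := by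
  have h' : LinearMap.ker (B : H →ₗ[ℂ] H) ≤ LinearMap.ker (A : H →ₗ[ℂ] H) :=
    Submodule.orthogonal_le_orthogonal_iff.1 h
  exact h' hv

lemma re_trace_eq_sum_inner [FiniteDimensional ℂ H] {ι : Type*} [Fintype ι]
    (f : OrthonormalBasis ι ℂ H) (A : H →L[ℂ] H) :
    (LinearMap.trace ℂ H (A : H →ₗ[ℂ] H)).re = ∑ j, (⟪f j, A (f j)⟫_ℂ).re := by
  rw [LinearMap.trace_eq_sum_inner _ f, Complex.re_sum]; rfl

section Sandwich

variable [CompleteSpace H]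

lemma sandwich_nonneg {ρ : H →L[ℂ] H} (hρ : 0 ≤ ρ) (σ : H →L[ℂ] H) (s : ℝ) :
    0 ≤ σ ^ s * ρ * σ ^ s :=
  (IsSelfAdjoint.of_nonneg CFC.rpow_nonneg).conjugate_nonneg hρ

variable [FiniteDimensional ℂ H]

lemma inner_sandwich_apply {σ : H →L[ℂ] H} (hσ : 0 ≤ σ) (ρ : H →L[ℂ] H) (s : ℝ) {u v : H}
    {a b : ℝ} (hu : σ u = (a : ℂ) • u) (hv : σ v = (b : ℂ) • v) :
    ⟪u, (σ ^ s * ρ * σ ^ s) v⟫_ℂ = ((a ^ s * b ^ s : ℝ) : ℂ) * ⟪u, ρ v⟫_ℂ := by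
  have hsym : ((σ ^ s : H →L[ℂ] H) : H →ₗ[ℂ] H).IsSymmetric :=
    ((nonneg_iff_isPositive _).1 (CFC.rpow_nonneg (a := σ) (y := s))).isSymmetric
  rw [mul_apply_eq_comp, mul_apply_eq_comp, rpow_apply_of_apply_eq_smul hσ hv, map_smul, map_smul,
    inner_smul_right, ← ContinuousLinearMap.coe_coe (σ ^ s), ← hsym,
    ContinuousLinearMap.coe_coe, rpow_apply_of_apply_eq_smul hσ hu, inner_smul_left,
    Complex.conj_ofReal]
  push_cast
  ring

/-- The trace functional of the sandwiched operator is at least one, with equality only for equal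
states. -/
lemma one_le_re_trace_sandwich_rpow {ρ σ : H →L[ℂ] H} (hρ : IsDensityOperator ρ)
    (hσ : IsDensityOperator σ) (hsupp : opSupport ρ ≤ opSupport σ) {α : ℝ} (hα : 1 < α) :
    1 ≤ (LinearMap.trace ℂ H (((σ ^ ((1 - α) / (2 * α)) * ρ * σ ^ ((1 - α) / (2 * α))) ^ α :
      H →L[ℂ] H) : H →ₗ[ℂ] H)).re ∧
    ((LinearMap.trace ℂ H (((σ ^ ((1 - α) / (2 * α)) * ρ * σ ^ ((1 - α) / (2 * α))) ^ α :
      H →L[ℂ] H) : H →ₗ[ℂ] H)).re = 1 → ρ = σ) := by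
  have hρ0 := (nonneg_iff_isPositive ρ).2 hρ.isPositive
  have hσ0 := (nonneg_iff_isPositive σ).2 hσ.isPositive
  have h0 : 0 < α := by linarith
  have h0' := h0.ne'
  obtain ⟨f, y, hy, hf⟩ := exists_eigenbasis_of_nonneg hσ0
  set s := (1 - α) / (2 * α) with hs
  set X := σ ^ s * ρ * σ ^ s with hXdef
  have hX : 0 ≤ X := sandwich_nonneg hρ0 σ s
  -- Since `0 ^ s = 0`, sandwiching erases `ρ` on the kernel of `σ`; support inclusion ensures that
  -- nothing is lost.
  have hker : ∀ j, y j = 0 → ρ (f j) = 0 := fun j hj =>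
    ker_le_ker_of_opSupport_le hsupp (by rw [hf, hj]; simp)
  have hexp : s + s = -((α - 1) / α) := by rw [hs]; field_simp; ring
  have htr : ∑ j, y j ^ ((α - 1) / α) * (⟪f j, X (f j)⟫_ℂ).re = 1 := by
    refine Eq.trans ?_ ((re_trace_eq_sum_inner f ρ).symm.trans
      (by rw [hρ.trace_eq_one, Complex.one_re]))
    refine Finset.sum_congr rfl fun j _ => ?_
    rw [hXdef, inner_sandwich_apply hσ0 ρ s (hf j) (hf j), Complex.re_ofReal_mul]
    rcases (hy j).eq_or_lt with h | h
    · simp [hker j h.symm]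
    · rw [← Real.rpow_add h, hexp, ← mul_assoc, ← Real.rpow_add h, add_neg_cancel,
        Real.rpow_zero, one_mul]
  have hysum : ∑ j, y j = 1 := by
    rw [← Complex.one_re, ← hσ.trace_eq_one, re_trace_eq_sum_inner f]
    refine Finset.sum_congr rfl fun j _ => ?_
    simp [hf]
  obtain ⟨hle, heq⟩ := sum_mul_re_inner_le hX f hy hα
  rw [htr, hysum, ← re_trace_eq_sum_inner] at hle heq
  have hsub : (α - 1) / α = 1 - 1 / α := by field_simp
  have hα1 : 0 < 1 / α := by positivity
  refine ⟨?_, fun hQ => ?_⟩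
  · rw [hsub] at hle
    by_contra! hlt
    nlinarith [mul_lt_mul_of_pos_left hlt hα1]
  · have hXf := heq (by rw [hQ, hsub]; ring)
    -- Where both eigenvalues are positive, the factor `y k ^ s * y j ^ s` relating entries of `X`
    -- and `ρ` can be cancelled.
    have hinner : ∀ k j, ⟪f k, ρ (f j)⟫_ℂ = ⟪f k, σ (f j)⟫_ℂ := by
      intro k j
      have hkj := inner_sandwich_apply hσ0 ρ s (hf k) (hf j)
      rw [← hXdef, hXf, inner_smul_right] at hkj
      rw [hf, inner_smul_right]
      rcases (hy j).eq_or_lt with hj | hj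
      · simp [hker j hj.symm, ← hj]
      rcases (hy k).eq_or_lt with hk | hk
      · have hkj' : k ≠ j := by rintro rfl; exact hj.ne hk
        rw [← ContinuousLinearMap.coe_coe ρ, ← hρ.isPositive.isSymmetric,
          ContinuousLinearMap.coe_coe, hker k hk.symm, inner_zero_left,
          f.inner_eq_zero hkj', mul_zero]
      by_cases hkj' : k = j
      · subst hkj'
        rw [f.inner_eq_one, mul_one] at hkj ⊢
        have hne : ((y k ^ s * y k ^ s : ℝ) : ℂ) ≠ 0 := by
          exact_mod_cast (mul_pos (Real.rpow_pos_of_pos hk s) (Real.rpow_pos_of_pos hk s)).ne'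
        refine mul_left_cancel₀ hne (hkj.symm.trans ?_)
        rw [← Complex.ofReal_mul, ← Real.rpow_add hk, hexp, hsub]
        nth_rw 3 [← Real.rpow_one (y k)]
        rw [← Real.rpow_add hk]
        congr 2
        ring
      · rw [f.inner_eq_zero hkj', mul_zero] at hkj ⊢
        have hne : ((y k ^ s * y j ^ s : ℝ) : ℂ) ≠ 0 := by
          exact_mod_cast (mul_pos (Real.rpow_pos_of_pos hk s) (Real.rpow_pos_of_pos hj s)).ne'
        exact (mul_eq_zero.1 hkj.symm).resolve_left hne
    refine ContinuousLinearMap.coe_injective (f.toBasis.ext fun j => ?_)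
    simp only [OrthonormalBasis.coe_toBasis, ContinuousLinearMap.coe_coe]
    exact InnerProductSpace.ext_inner_left_basis f.toBasis fun k => by simpa using hinner k j

/-- Here the sandwiched operator is `σ ^ (1 / α)`, whose `α`-th power is `σ`. -/
lemma re_trace_sandwich_self_rpow {σ : H →L[ℂ] H} (hσ : IsDensityOperator σ) {α : ℝ}
    (hα : 1 < α) :
    (LinearMap.trace ℂ H (((σ ^ ((1 - α) / (2 * α)) * σ * σ ^ ((1 - α) / (2 * α))) ^ α :
      H →L[ℂ] H) : H →ₗ[ℂ] H)).re = 1 := by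
  have hσ0 := (nonneg_iff_isPositive σ).2 hσ.isPositive
  have h0 : 0 < α := by linarith
  obtain ⟨f, y, hy, hf⟩ := exists_eigenbasis_of_nonneg hσ0
  set s := (1 - α) / (2 * α) with hs
  rw [← Complex.one_re, ← hσ.trace_eq_one, re_trace_eq_sum_inner f, re_trace_eq_sum_inner f]
  refine Finset.sum_congr rfl fun j _ => ?_
  have hX : (σ ^ s * σ * σ ^ s) (f j) = ((y j ^ (1 / α) : ℝ) : ℂ) • f j := by
    rw [mul_apply_eq_comp, mul_apply_eq_comp, rpow_apply_of_apply_eq_smul hσ0 (hf j), map_smul, map_smul, hf,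
      map_smul, rpow_apply_of_apply_eq_smul hσ0 (hf j), smul_smul, smul_smul,
      ← Complex.ofReal_mul, ← Complex.ofReal_mul]
    congr 2
    rcases (hy j).eq_or_lt with h | h
    · rw [← h, Real.zero_rpow (one_div_pos.2 h0).ne', mul_zero, zero_mul]
    · nth_rw 2 [← Real.rpow_one (y j)]
      rw [← Real.rpow_add h, ← Real.rpow_add h, hs]
      congr 1
      field_simp
      ring
  rw [rpow_apply_of_apply_eq_smul (sandwich_nonneg hσ0 σ s) hX, ← Real.rpow_mul (hy j),
    one_div_mul_cancel h0.ne', Real.rpow_one, hf]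

end Sandwich

end Operators

theorem mainTheorem10 {H : Type*} [NormedAddCommGroup H] [InnerProductSpace ℂ H]
    [FiniteDimensional ℂ H] [CompleteSpace H] (ρ σ : H →L[ℂ] H)
    (hρ : IsDensityOperator ρ) (hσ : IsDensityOperator σ)
    (α : ℝ) (hα : 1 < α) (hα' : α ≤ 2) :
    0 ≤ sandwichedRenyiEntropy α ρ σ ∧
      (sandwichedRenyiEntropy α ρ σ = 0 ↔ ρ = σ) := by
  have hc : (0 : EReal) < ((1 / (α - 1) : ℝ) : EReal) :=
    EReal.coe_pos.2 (one_div_pos.2 (by linarith))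
  have hc' : (0 : EReal) < ((1 / Real.log 2 : ℝ) : EReal) :=
    EReal.coe_pos.2 (one_div_pos.2 (Real.log_pos one_lt_two))
  -- Both prefactors are nonzero, so only the logarithm can vanish.
  have hiff : sandwichedRenyiEntropy α ρ σ = 0 ↔ sandwichedQuasiEntropy α ρ σ = 1 := by
    simp only [sandwichedRenyiEntropy, mul_eq_zero, hc.ne', hc'.ne', false_or,
      ENNReal.log_eq_one_iff]
  refine ⟨EReal.mul_nonneg hc.le (EReal.mul_nonneg hc'.le (ENNReal.zero_le_log_iff.2 ?_)),
    hiff.trans ⟨fun h => ?_, fun h => ?_⟩⟩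
  · unfold sandwichedQuasiEntropy
    split_ifs with hsupp
    · exact ENNReal.one_le_ofReal.2 (one_le_re_trace_sandwich_rpow hρ hσ hsupp hα).1
    · exact le_top
  · unfold sandwichedQuasiEntropy at h
    split_ifs at h with hsupp
    · exact (one_le_re_trace_sandwich_rpow hρ hσ hsupp hα).2 (ENNReal.ofReal_eq_one.1 h)
    · exact absurd h ENNReal.top_ne_one
  · subst h
    rw [sandwichedQuasiEntropy, if_pos le_rfl, re_trace_sandwich_self_rpow hρ hα,
      ENNReal.ofReal_one]
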